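/- Let $G$ be a profinite group. A spectrum is a Bousfield--Friedlander spectrum of simplicial sets, i.e. a sequence of pointed simplicial sets $X_k$ ($k\ge 0$) with bonding maps $S^1\wedge X_k\to X_{k+1}$; let $\mathrm{Spt}$ be the category of spectra. A discrete $G$-spectrum is a spectrum with a $G$-action such that, for all $k,l\ge 0$, the action map $G\times (X_k)_l\to (X_k)_l$ is continuous when the set $(X_k)_l$ of $l$-simplices is given the discrete topology; let $\mathrm{Spt}_G$ be the category of discrete $G$-spectra and $G$-equivariant maps of spectra. For $\mathcal M=\mathrm{Spt}$ or $\mathrm{Spt}_G$ and a simplicial set $K$, let $Y\mapsto Y^K$ be the cotensor in $\mathcal M$, that is, the right adjoint of the functor $A\mapsto A\wedge K_+$ on $\mathcal M$ (where $G$ acts on $A$ only). For a small category $\mathcal C$ and a functor $X\colon\mathcal C\to\mathcal M$, the homotopy limit $\operatorname{holim}^{\mathcal M}_{\mathcal C}X$ is the equalizer in $\mathcal M$ of the two maps \[ \alpha,\beta\colon \prod_{c\in\mathcal C}X(c)^{B(\mathcal C\downarrow c)}\rightrightarrows\prod_{\sigma\colon c\to d}X(d)^{B(\mathcal C\downarrow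 c)}, \] where $B$ denotes the nerve, the second product is over all morphisms of $\mathcal C$, and, on the factor of $\sigma\colon c\to d$, $\alpha$ is the projection to $X(c)^{B(\mathcal C\downarrow c)}$ followed by the map induced by $X(\sigma)$, and $\beta$ is the projection to $X(d)^{B(\mathcal C\downarrow d)}$ followed by the map induced by $B(\mathcal C\downarrow c)\to B(\mathcal C\downarrow d)$. Let $\mathcal C$ be a small category and $X\colon \mathcal C\to\mathrm{Spt}_G$ a functor. Let $\operatorname{holim}_{\mathcal C}X$ be the homotopy limit in $\mathrm{Spt}$ of the underlying diagram of spectra, with the $G$-action induced by functoriality. Then there is an isomorphism of discrete $G$-spectra \[ \operatorname{holim}^{\mathrm{Spt}_G}_{\mathcal C}X\;\cong\;\operatorname*{colim}_{N\vartriangleleft_o G}\,(\operatorname{holim}_{\mathcal C}X)^N, \] where $N$ runs over the open normal subgroups of $G$, the transition maps are the inclusions of fixed points, and the colimit exists in $\mathrm{Spt}_G$ and is also the colimit in $\mathrm{Spt}$ of the underlying diagram. -/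

import Mathlib

open CategoryTheory Limits Opposite Simplicial

universe u

/-- A pointed simplicial set: a simplicial set with a base point in each degree, compatible with
all the simplicial operators (that is, a map from the terminal simplicial set). -/
structure PSSet where
  X : SSet.{u}
  pt : ∀ n, X.obj n
  map_pt : ∀ {m n : SimplexCategoryᵒᵖ} (f : m ⟶ n), X.map f (pt m) = pt n

namespace PSSet

attribute [simp] map_pt

@[ext]
structure Hom (A B : PSSet.{u}) where
  hom : A.X ⟶ B.X
  app_pt : ∀ n, hom.app n (A.pt n) = B.pt n

attribute [simp] Hom.app_pt

instance : Category PSSet.{u} where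
  Hom := Hom
  id A := ⟨𝟙 A.X, fun _ => rfl⟩
  comp f g := ⟨f.hom ≫ g.hom, fun n => by simp⟩

/-- The effect of a map of pointed simplicial sets on `n`-simplices. -/
def ap {A B : PSSet.{u}} (f : A ⟶ B) (n : SimplexCategoryᵒᵖ) (x : A.X.obj n) : B.X.obj n :=
  (Hom.hom f).app n x

@[simp] lemma ap_id (A : PSSet.{u}) (n) (x : A.X.obj n) : ap (𝟙 A) n x = x := rfl

@[simp] lemma ap_comp {A B C : PSSet.{u}} (f : A ⟶ B) (g : B ⟶ C) (n) (x : A.X.obj n) :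
    ap (f ≫ g) n x = ap g n (ap f n x) := rfl

@[simp] lemma ap_pt {A B : PSSet.{u}} (f : A ⟶ B) (n) : ap f n (A.pt n) = B.pt n :=
  Hom.app_pt f n

lemma ap_map {A B : PSSet.{u}} (f : A ⟶ B) {m n} (s : m ⟶ n) (x : A.X.obj m) :
    ap f n (A.X.map s x) = B.X.map s (ap f m x) :=
  NatTrans.naturality_apply (Hom.hom f) s x

lemma hom_ext {A B : PSSet.{u}} {f g : A ⟶ B} (h : ∀ n x, ap f n x = ap g n x) : f = g := by
  apply Hom.ext
  ext n x
  exact h n x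

/-- Constructor for maps of pointed simplicial sets from functions on simplices. -/
def mkHom {A B : PSSet.{u}} (f : ∀ n, A.X.obj n → B.X.obj n)
    (hmap : ∀ {m n} (s : m ⟶ n) (x : A.X.obj m), f n (A.X.map s x) = B.X.map s (f m x))
    (hpt : ∀ n, f n (A.pt n) = B.pt n) : A ⟶ B :=
  Hom.mk { app := fun n => ↾(f n), naturality := fun _ _ s => by ext x; exact hmap s x } hpt

@[simp] lemma ap_mkHom {A B : PSSet.{u}} (f : ∀ n, A.X.obj n → B.X.obj n) (hmap) (hpt) (n) (x) :
    ap (mkHom (A := A) (B := B) f hmap hpt) n x = f n x := rfl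

/-- The relation on `A_n × B_n` that collapses the wedge `A_n ∨ B_n` to a point. -/
def smashRel (A B : PSSet.{u}) (n : SimplexCategoryᵒᵖ) (p q : A.X.obj n × B.X.obj n) : Prop :=
  (p.1 = A.pt n ∨ p.2 = B.pt n) ∧ (q.1 = A.pt n ∨ q.2 = B.pt n)

/-- The smash product `A ∧ B = (A × B) / (A ∨ B)` of pointed simplicial sets. -/
def smash (A B : PSSet.{u}) : PSSet.{u} where
  X :=
    { obj := fun n => Quot (smashRel A B n)
      map := fun {m n} s => ↾(Quot.map (fun p => (A.X.map s p.1, B.X.map s p.2)) (by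
        rintro ⟨a, b⟩ ⟨a', b'⟩ ⟨h, h'⟩
        refine ⟨h.imp ?_ ?_, h'.imp ?_ ?_⟩ <;> (intro h; dsimp only at h ⊢; rw [h]; simp)))
      map_id := fun n => by
        ext ⟨p⟩
        simp [Quot.map]
      map_comp := fun s t => by
        ext ⟨p⟩
        simp [Quot.map] }
  pt n := Quot.mk _ (A.pt n, B.pt n)
  map_pt s := by
    change Quot.mk _ (A.X.map s (A.pt _), B.X.map s (B.pt _)) = _
    simp

/-- The class of the pair `(a, b)` in the smash product. -/
def smk {A B : PSSet.{u}} {n : SimplexCategoryᵒᵖ} (a : A.X.obj n) (b : B.X.obj n) :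
    (smash A B).X.obj n := Quot.mk _ (a, b)

lemma smash_map {A B : PSSet.{u}} {m n : SimplexCategoryᵒᵖ} (s : m ⟶ n) (a : A.X.obj m)
    (b : B.X.obj m) : (smash A B).X.map s (smk a b) = smk (A.X.map s a) (B.X.map s b) := rfl

lemma smash_pt {A B : PSSet.{u}} (n) : (smash A B).pt n = smk (A.pt n) (B.pt n) := rfl

lemma smk_left {A B : PSSet.{u}} {n} (b : B.X.obj n) :
    smk (A.pt n) b = (smash A B).pt n := Quot.sound ⟨Or.inl rfl, Or.inl rfl⟩

lemma smk_right {A B : PSSet.{u}} {n} (a : A.X.obj n) :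
    smk a (B.pt n) = (smash A B).pt n := Quot.sound ⟨Or.inr rfl, Or.inl rfl⟩

lemma smash_ind {A B : PSSet.{u}} {n} {P : (smash A B).X.obj n → Prop}
    (h : ∀ a b, P (smk a b)) (x) : P x := by
  rcases x with ⟨a, b⟩
  exact h a b

/-- Functions out of the `n`-simplices of a smash product. -/
def smashLift {A B : PSSet.{u}} {n} {T : Type*} (f : A.X.obj n → B.X.obj n → T) (t : T)
    (hl : ∀ b, f (A.pt n) b = t) (hr : ∀ a, f a (B.pt n) = t) (x : (smash A B).X.obj n) : T :=
  Quot.lift (fun p : A.X.obj n × B.X.obj n => f p.1 p.2) (by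
    have key : ∀ p : A.X.obj n × B.X.obj n, (p.1 = A.pt n ∨ p.2 = B.pt n) → f p.1 p.2 = t := by
      rintro ⟨a, b⟩ (h | h) <;> (dsimp only at h ⊢; subst h; simp [hl, hr])
    rintro p q ⟨h, h'⟩
    exact (key p h).trans (key q h').symm) x

@[simp] lemma smashLift_smk {A B : PSSet.{u}} {n} {T : Type*} (f : A.X.obj n → B.X.obj n → T)
    (t : T) (hl hr) (a : A.X.obj n) (b : B.X.obj n) :
    smashLift f t hl hr (smk a b) = f a b := rfl

/-- Maps out of a smash product. -/
def smashDesc {A B C : PSSet.{u}} (f : ∀ n, A.X.obj n → B.X.obj n → C.X.obj n)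
    (hl : ∀ n b, f n (A.pt n) b = C.pt n) (hr : ∀ n a, f n a (B.pt n) = C.pt n)
    (hmap : ∀ {m n} (s : m ⟶ n) a b, f n (A.X.map s a) (B.X.map s b) = C.X.map s (f m a b)) :
    smash A B ⟶ C :=
  mkHom (fun n => smashLift (f n) (C.pt n) (hl n) (hr n))
    (fun {m n} s x => by
      induction x using smash_ind with
      | h a b => simp [smash_map, hmap])
    (fun n => by simp [smash_pt, hl])

@[simp] lemma smashDesc_smk {A B C : PSSet.{u}} (f : ∀ n, A.X.obj n → B.X.obj n → C.X.obj n)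
    (hl) (hr) (hmap) (n) (a : A.X.obj n) (b : B.X.obj n) :
    ap (smashDesc (C := C) f hl hr hmap) n (smk a b) = f n a b := rfl

/-- The functoriality of the smash product. -/
def smashMap {A A' B B' : PSSet.{u}} (f : A ⟶ A') (g : B ⟶ B') : smash A B ⟶ smash A' B' :=
  smashDesc (fun n a b => smk (ap f n a) (ap g n b)) (fun n b => by simp [smk_left])
    (fun n a => by simp [smk_right]) (fun s a b => by simp [ap_map, smash_map])

@[simp] lemma smashMap_smk {A A' B B' : PSSet.{u}} (f : A ⟶ A') (g : B ⟶ B') (n)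
    (a : A.X.obj n) (b : B.X.obj n) :
    ap (smashMap f g) n (smk a b) = smk (ap f n a) (ap g n b) := rfl

/-- The associativity map `A ∧ (B ∧ C) ⟶ (A ∧ B) ∧ C`. -/
def smashAssoc (A B C : PSSet.{u}) : smash A (smash B C) ⟶ smash (smash A B) C :=
  smashDesc
    (fun n a => smashLift (fun b c => smk (smk a b) c) ((smash (smash A B) C).pt n)
      (fun c => by rw [smk_right, smk_left]) (fun b => by rw [smk_right]))
    (fun n x => by
      induction x using smash_ind with
      | h b c => rw [smashLift_smk, smk_left, smk_left])
    (fun n a => smk_right (smk a (B.pt n)))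
    (fun {m n} s a x => by
      induction x using smash_ind with
      | h b c => simp [smash_map])

@[simp] lemma smashAssoc_smk {A B C : PSSet.{u}} {n} (a : A.X.obj n) (b : B.X.obj n)
    (c : C.X.obj n) : ap (smashAssoc A B C) n (smk a (smk b c)) = smk (smk a b) c := rfl

/-- `K₊`, the simplicial set `K` with a disjoint base point. -/
def plus (K : SSet.{u}) : PSSet.{u} where
  X :=
    { obj := fun n => Option (K.obj n)
      map := fun s => ↾(Option.map (K.map s))
      map_id := fun n => by ext (_ | x) <;> simp
      map_comp := fun s t => by ext (_ | x) <;> simp }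
  pt _ := none
  map_pt _ := rfl

lemma plus_map_some {K : SSet.{u}} {m n : SimplexCategoryᵒᵖ} (s : m ⟶ n) (x : K.obj m) :
    (plus K).X.map s (some x : Option (K.obj m)) = (some (K.map s x) : Option (K.obj n)) := rfl

/-- The functoriality of `K ↦ K₊`. -/
def plusMap {K L : SSet.{u}} (f : K ⟶ L) : plus K ⟶ plus L :=
  mkHom (fun n => Option.map (f.app n))
    (fun {m n} s x => by
      rcases x with _ | x
      · rfl
      · exact congrArg some (NatTrans.naturality_apply f s x))
    (fun _ => rfl)

/-- The simplicial circle `S¹ = Δ¹ / ∂Δ¹`, pointed by the class of `∂Δ¹`. -/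
def circle : PSSet.{u} where
  X :=
    { obj := fun n => Quot (fun x y : (Δ[1] : SSet.{u}).obj n =>
        x ∈ (SSet.boundary.{u} 1).obj n ∧ y ∈ (SSet.boundary.{u} 1).obj n)
      map := fun s => ↾(Quot.map ((Δ[1] : SSet.{u}).map s) (fun _ _ h =>
        ⟨(SSet.boundary 1).map s h.1, (SSet.boundary 1).map s h.2⟩))
      map_id := fun n => by
        ext ⟨p⟩
        simp [Quot.map]
      map_comp := fun s t => by
        ext ⟨p⟩
        simp [Quot.map] }
  pt n := Quot.mk _ (SSet.stdSimplex.const 1 0 n)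
  map_pt _ := rfl

end PSSet

/-- A (Bousfield-Friedlander) spectrum of simplicial sets: pointed simplicial sets `X_k` with
bonding maps `S¹ ∧ X_k ⟶ X_{k+1}`. -/
structure Spt where
  level : ℕ → PSSet.{u}
  bond : ∀ k, PSSet.smash PSSet.circle (level k) ⟶ level (k + 1)

namespace Spt

open PSSet

@[ext]
structure Hom (X Y : Spt.{u}) where
  app : ∀ k, X.level k ⟶ Y.level k
  comm : ∀ k, smashMap (𝟙 circle) (app k) ≫ Y.bond k = X.bond k ≫ app (k + 1)

/-- The `n`-simplices of the `k`-th level of a spectrum. -/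
abbrev S (X : Spt.{u}) (k : ℕ) (n : SimplexCategoryᵒᵖ) : Type u := (X.level k).X.obj n

/-- The bonding map evaluated on the class of a pair of simplices. -/
def bd (X : Spt.{u}) (k : ℕ) (n : SimplexCategoryᵒᵖ) (s : circle.{u}.X.obj n) (x : X.S k n) :
    X.S (k + 1) n := ap (X.bond k) n (smk s x)

@[simp] lemma bd_pt (X : Spt.{u}) (k n) (s) : X.bd k n s ((X.level k).pt n)
    = (X.level (k + 1)).pt n := by rw [bd, smk_right, ap_pt]

@[simp] lemma bd_pt_left (X : Spt.{u}) (k n) (x) : X.bd k n (circle.pt n) x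
    = (X.level (k + 1)).pt n := by rw [bd, smk_left, ap_pt]

lemma bd_map (X : Spt.{u}) (k) {m n} (t : m ⟶ n) (s) (x : X.S k m) :
    X.bd k n (circle.X.map t s) ((X.level k).X.map t x)
    = (X.level (k + 1)).X.map t (X.bd k m s x) := by
  rw [bd, ← smash_map, ap_map, bd]

/-- Constructor for spectra from functions `S¹_n × (X_k)_n → (X_{k+1})_n` that vanish on the
wedge. -/
def mk' (L : ℕ → PSSet.{u})
    (f : ∀ k n, circle.{u}.X.obj n → (L k).X.obj n → (L (k + 1)).X.obj n)
    (hl : ∀ k n x, f k n (circle.pt n) x = (L (k + 1)).pt n)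
    (hr : ∀ k n s, f k n s ((L k).pt n) = (L (k + 1)).pt n)
    (hmap : ∀ k {m n} (t : m ⟶ n) s x,
      f k n (circle.X.map t s) ((L k).X.map t x) = (L (k + 1)).X.map t (f k m s x)) : Spt.{u} where
  level := L
  bond k := smashDesc (f k) (hl k) (hr k) (hmap k)

lemma Hom.app_bd {X Y : Spt.{u}} (f : Hom X Y) (k n) (s) (x : X.S k n) :
    ap (f.app (k + 1)) n (X.bd k n s x) = Y.bd k n s (ap (f.app k) n x) := by
  have := congrArg (fun φ => ap φ n (smk s x)) (f.comm k)
  simpa [bd] using this.symm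

lemma comm_of_bd {X Y : Spt.{u}} (f : ∀ k, X.level k ⟶ Y.level k)
    (h : ∀ k n s (x : X.S k n), ap (f (k + 1)) n (X.bd k n s x) = Y.bd k n s (ap (f k) n x)) (k) :
    smashMap (𝟙 circle) (f k) ≫ Y.bond k = X.bond k ≫ f (k + 1) := by
  apply PSSet.hom_ext
  intro n x
  induction x using smash_ind with
  | h a b => exact (h k n a b).symm

instance : Category Spt.{u} where
  Hom := Hom
  id X := ⟨fun k => 𝟙 _, comm_of_bd _ fun k n s x => by simp⟩
  comp f g := ⟨fun k => f.app k ≫ g.app k, comm_of_bd _ fun k n s x => by simp [Hom.app_bd]⟩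

/-- The effect of a map of spectra on simplices. -/
def ev {X Y : Spt.{u}} (f : X ⟶ Y) (k : ℕ) (n : SimplexCategoryᵒᵖ) (x : X.S k n) : Y.S k n :=
  ap (Hom.app f k) n x

@[simp] lemma ev_id (X : Spt.{u}) (k n) (x : X.S k n) : ev (𝟙 X) k n x = x := rfl

@[simp] lemma ev_comp {X Y Z : Spt.{u}} (f : X ⟶ Y) (g : Y ⟶ Z) (k n) (x : X.S k n) :
    ev (f ≫ g) k n x = ev g k n (ev f k n x) := rfl

@[simp] lemma ev_pt {X Y : Spt.{u}} (f : X ⟶ Y) (k n) :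
    ev f k n ((X.level k).pt n) = (Y.level k).pt n := ap_pt _ _

lemma ev_map {X Y : Spt.{u}} (f : X ⟶ Y) (k) {m n} (s : m ⟶ n) (x : X.S k m) :
    ev f k n ((X.level k).X.map s x) = (Y.level k).X.map s (ev f k m x) := ap_map _ _ _

lemma ev_bd {X Y : Spt.{u}} (f : X ⟶ Y) (k n) (s) (x : X.S k n) :
    ev f (k + 1) n (X.bd k n s x) = Y.bd k n s (ev f k n x) := Hom.app_bd f k n s x

lemma hom_ext {X Y : Spt.{u}} {f g : X ⟶ Y} (h : ∀ k n x, ev f k n x = ev g k n x) : f = g := by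
  apply Hom.ext
  funext k
  exact PSSet.hom_ext (h k)

lemma congr_ev {X Y : Spt.{u}} {f g : X ⟶ Y} (h : f = g) (k n) (x : X.S k n) :
    ev f k n x = ev g k n x := by rw [h]

/-- Constructor for maps of spectra from functions on simplices. -/
def mkHom {X Y : Spt.{u}} (f : ∀ k n, X.S k n → Y.S k n)
    (hmap : ∀ k {m n} (s : m ⟶ n) (x : X.S k m),
      f k n ((X.level k).X.map s x) = (Y.level k).X.map s (f k m x))
    (hpt : ∀ k n, f k n ((X.level k).pt n) = (Y.level k).pt n)
    (hbd : ∀ k n s (x : X.S k n), f (k + 1) n (X.bd k n s x) = Y.bd k n s (f k n x)) : X ⟶ Y :=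
  Hom.mk (fun k => PSSet.mkHom (f k) (hmap k) (hpt k)) (comm_of_bd _ hbd)

@[simp] lemma ev_mkHom {X Y : Spt.{u}} (f : ∀ k n, X.S k n → Y.S k n) (hmap hpt hbd) (k n x) :
    ev (mkHom (X := X) (Y := Y) f hmap hpt hbd) k n x = f k n x := rfl

/-! ### Limits of spectra -/

section Limits

variable {J : Type u} [SmallCategory J] (F : J ⥤ Spt.{u})

/-- The limit of a diagram of spectra, formed on simplices. -/
def lim : Spt.{u} :=
  mk'
    (fun k =>
      { X :=
          { obj := fun n => { s : ∀ j, (F.obj j).S k n //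
              ∀ {i j} (f : i ⟶ j), ev (F.map f) k n (s i) = s j }
            map := fun t => ↾fun s => ⟨fun j => ((F.obj j).level k).X.map t (s.1 j),
              fun f => by rw [ev_map, s.2 f]⟩
            map_id := fun n => by ext s j; simp
            map_comp := fun s t => by ext s j; simp }
        pt := fun n => ⟨fun j => ((F.obj j).level k).pt n, fun f => by simp⟩
        map_pt := fun t => by apply Subtype.ext; funext j; simp })
    (fun k n s x => ⟨fun j => (F.obj j).bd k n s (x.1 j), fun f => by rw [ev_bd, x.2 f]⟩)
    (fun k n x => by apply Subtype.ext; funext j; simp)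
    (fun k n s => by apply Subtype.ext; funext j; simp)
    (fun k m n t s x => by
      apply Subtype.ext; funext j
      exact bd_map _ k t s _)

/-- The limit cone on `lim F`. -/
def limCone : Cone F where
  pt := lim F
  π :=
    { app := fun j => mkHom (fun k n s => s.1 j) (fun _ _ _ _ _ => rfl) (fun _ _ => rfl)
        (fun _ _ _ _ => rfl)
      naturality := fun i j f => by
        apply hom_ext
        intro k n x
        exact (x.2 f).symm }

/-- The universal property of `lim F`. -/
def limConeIsLimit : IsLimit (limCone F) where
  lift c := mkHom (fun k n x => ⟨fun j => ev (c.π.app j) k n x,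
      fun f => by rw [← ev_comp]; exact congr_ev (c.w f) k n x⟩)
    (fun k m n s x => by apply Subtype.ext; funext j; exact ev_map _ _ _ _)
    (fun k n => by apply Subtype.ext; funext j; exact ev_pt _ _ _)
    (fun k n s x => by apply Subtype.ext; funext j; exact ev_bd _ _ _ _ _)
  fac c j := rfl
  uniq c m h := by
    apply hom_ext
    intro k n x
    apply Subtype.ext
    funext j
    exact congr_ev (h j) k n x

end Limits

instance : HasLimits Spt.{u} where
  has_limits_of_shape _ := ⟨fun F => ⟨⟨⟨limCone F, limConeIsLimit F⟩⟩⟩⟩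

/-! ### Tensors and cotensors with simplicial sets -/

/-- The tensor `X ∧ K₊`: level `k` is `X_k ∧ K₊`, and the bonding maps are
`S¹ ∧ (X_k ∧ K₊) ≅ (S¹ ∧ X_k) ∧ K₊ ⟶ X_{k+1} ∧ K₊`. -/
def tens (X : Spt.{u}) (K : SSet.{u}) : Spt.{u} where
  level k := smash (X.level k) (plus K)
  bond k := smashAssoc _ _ _ ≫ smashMap (X.bond k) (𝟙 _)

/-- The class of a pair of simplices in `X ∧ K₊`. -/
def tmk {X : Spt.{u}} {K : SSet.{u}} {k : ℕ} {n : SimplexCategoryᵒᵖ} (x : X.S k n)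
    (y : Option (K.obj n)) : (tens X K).S k n := smk (B := plus K) x y

lemma tens_ind {X : Spt.{u}} {K : SSet.{u}} {k n} {P : (tens X K).S k n → Prop}
    (h : ∀ x y, P (tmk x y)) (z) : P z := smash_ind (P := P) h z

lemma tens_bd (X : Spt.{u}) (K : SSet.{u}) (k n s) (x : X.S k n) (y : Option (K.obj n)) :
    (tens X K).bd k n s (tmk x y) = tmk (X.bd k n s x) y := rfl

lemma tmk_none {X : Spt.{u}} {K : SSet.{u}} {k n} (x : X.S k n) :
    tmk x (none : Option (K.obj n)) = ((tens X K).level k).pt n := smk_right (B := plus K) x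

lemma tmk_pt {X : Spt.{u}} {K : SSet.{u}} {k n} (y : Option (K.obj n)) :
    tmk ((X.level k).pt n) y = ((tens X K).level k).pt n := smk_left (B := plus K) y

lemma tens_map {X : Spt.{u}} {K : SSet.{u}} {k m n} (s : m ⟶ n) (x : X.S k m) (y : K.obj m) :
    ((tens X K).level k).X.map s (tmk x (some y)) =
      tmk ((X.level k).X.map s x) (some (K.map s y)) := rfl

/-- The functoriality of `X ∧ K₊` in both variables. -/
def tensMap {X Y : Spt.{u}} {K L : SSet.{u}} (f : X ⟶ Y) (g : K ⟶ L) : tens X K ⟶ tens Y L :=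
  Hom.mk (fun k => smashMap (Hom.app f k) (plusMap g)) (comm_of_bd _ fun k n s x => by
    induction x using tens_ind with
    | h a b => exact congrArg (fun z => tmk z (b.map (g.app n))) (ev_bd f k n s a))

lemma ev_tensMap {X Y : Spt.{u}} {K L : SSet.{u}} (f : X ⟶ Y) (g : K ⟶ L) (k n) (x : X.S k n)
    (y : Option (K.obj n)) :
    ev (tensMap f g) k n (tmk x y) = tmk (ev f k n x) (y.map (g.app n)) := rfl

/-- The tensoring of spectra over simplicial sets, `K ↦ (X ↦ X ∧ K₊)`. -/
def tensor : SSet.{u} ⥤ Spt.{u} ⥤ Spt.{u} where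
  obj K :=
    { obj := fun X => tens X K
      map := fun f => tensMap f (𝟙 K)
      map_id := fun X => by
        apply hom_ext
        intro k n x
        induction x using tens_ind with
        | h a b => rcases b with _ | b <;> rfl
      map_comp := fun f g => by
        apply hom_ext
        intro k n x
        induction x using tens_ind with
        | h a b => rcases b with _ | b <;> rfl }
  map g :=
    { app := fun X => tensMap (𝟙 X) g
      naturality := fun X Y f => by
        apply hom_ext
        intro k n x
        induction x using tens_ind with
        | h a b => rcases b with _ | b <;> rfl }
  map_id K := by
    ext X : 2
    apply hom_ext
    intro k n x
    induction x using tens_ind with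
    | h a b => rcases b with _ | b <;> rfl
  map_comp f g := by
    ext X : 2
    apply hom_ext
    intro k n x
    induction x using tens_ind with
    | h a b => rcases b with _ | b <;> rfl

/-- An `n`-simplex of the mapping space `Map(K, A)`: a map `Δⁿ × K ⟶ A`, written as a natural
family of functions `(Δⁿ)_m → K_m → A_m`. -/
@[ext]
structure MapS (K : SSet.{u}) (A : PSSet.{u}) (n : SimplexCategoryᵒᵖ) where
  fn : ∀ m, (n ⟶ m) → K.obj m → A.X.obj m
  nat : ∀ {m l} (t : m ⟶ l) (a : n ⟶ m) (x : K.obj m), fn l (a ≫ t) (K.map t x) =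
    A.X.map t (fn m a x)

/-- The mapping space `Map(K, A)`, pointed by the constant map at the base point. -/
def mapSpace (K : SSet.{u}) (A : PSSet.{u}) : PSSet.{u} where
  X :=
    { obj := fun n => MapS K A n
      map := fun t => ↾fun φ => ⟨fun m a x => φ.fn m (t ≫ a) x, fun s a x => by
        rw [← φ.nat, Category.assoc]⟩
      map_id := fun n => by ext φ m a x; simp
      map_comp := fun s t => by ext φ m a x; simp }
  pt n := ⟨fun m _ _ => A.pt m, fun _ _ _ => by simp⟩
  map_pt _ := rfl

/-- The spectrum with levels `Map(K, X_k)`. -/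
def cot (K : SSet.{u}) (X : Spt.{u}) : Spt.{u} :=
  mk' (fun k => mapSpace K (X.level k))
    (fun k n s φ => ⟨fun m a x => X.bd k m (circle.X.map a s) (φ.fn m a x), fun t a x => by
      rw [φ.nat, ← bd_map, Functor.map_comp_apply]⟩)
    (fun k n φ => by
      apply MapS.ext; funext m a x
      change X.bd k m (circle.X.map a (circle.pt n)) _ = _
      rw [PSSet.map_pt, bd_pt_left]; rfl)
    (fun k n s => by
      apply MapS.ext; funext m a x
      exact bd_pt _ _ _ _)
    (fun k m n t s φ => by
      apply MapS.ext; funext l a x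
      change X.bd k l (circle.X.map a (circle.X.map t s)) _ = X.bd k l (circle.X.map (t ≫ a) s) _
      rw [Functor.map_comp_apply]; rfl)

/-- The value of a simplex of `Map(K, X_k)`. -/
def cfn {K : SSet.{u}} {X : Spt.{u}} {k : ℕ} {n : SimplexCategoryᵒᵖ} (φ : (cot K X).S k n)
    (m) (a : n ⟶ m) (x : K.obj m) : X.S k m := MapS.fn φ m a x

lemma cot_ext {K : SSet.{u}} {X : Spt.{u}} {k n} {φ ψ : (cot K X).S k n}
    (h : ∀ m a x, cfn φ m a x = cfn ψ m a x) : φ = ψ :=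
  MapS.ext (by funext m a x; exact h m a x)

lemma cfn_nat {K : SSet.{u}} {X : Spt.{u}} {k n} (φ : (cot K X).S k n) {m l} (t : m ⟶ l)
    (a : n ⟶ m) (x : K.obj m) :
    cfn φ l (a ≫ t) (K.map t x) = (X.level k).X.map t (cfn φ m a x) := MapS.nat φ t a x

lemma cfn_map {K : SSet.{u}} {X : Spt.{u}} {k n n'} (s : n ⟶ n') (φ : (cot K X).S k n) (m)
    (a : n' ⟶ m) (x : K.obj m) :
    cfn (((cot K X).level k).X.map s φ) m a x = cfn φ m (s ≫ a) x := rfl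

lemma cfn_pt {K : SSet.{u}} {X : Spt.{u}} {k n} (m) (a : n ⟶ m) (x : K.obj m) :
    cfn (((cot K X).level k).pt n) m a x = (X.level k).pt m := rfl

lemma cfn_bd {K : SSet.{u}} {X : Spt.{u}} {k n} (s) (φ : (cot K X).S k n) (m)
    (a : n ⟶ m) (x : K.obj m) :
    cfn ((cot K X).bd k n s φ) m a x = X.bd k m (circle.X.map a s) (cfn φ m a x) := rfl

/-- The map `A ⟶ Map(K, Y)` adjoint to `A ∧ K₊ ⟶ Y`. -/
def curry {K : SSet.{u}} {A Y : Spt.{u}} (f : tens A K ⟶ Y) : A ⟶ cot K Y :=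
  mkHom
    (fun k n a => MapS.mk (fun m t x => ev f k m (tmk ((A.level k).X.map t a) (some x)))
      (fun {m l} t b x => by rw [Functor.map_comp_apply, ← tens_map, ev_map]))
    (fun k m n s a => by
      apply cot_ext; intro l t x
      change ev f k l (tmk _ _) = ev f k l (tmk ((A.level k).X.map (s ≫ t) a) _)
      rw [Functor.map_comp_apply])
    (fun k n => by
      apply cot_ext; intro l t x
      change ev f k l (tmk _ _) = _
      rw [PSSet.map_pt, tmk_pt, ev_pt]; rfl)
    (fun k n s a => by
      apply cot_ext; intro l t x
      change ev f (k + 1) l (tmk _ _) = Y.bd k l (circle.X.map t s) (ev f k l (tmk _ _))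
      rw [← ev_bd, tens_bd, bd_map])

lemma cfn_curry {K : SSet.{u}} {A Y : Spt.{u}} (f : tens A K ⟶ Y) (k n a m) (t : n ⟶ m) (x) :
    cfn (ev (curry f) k n a) m t x = ev f k m (tmk ((A.level k).X.map t a) (some x)) := rfl

/-- The map `A ∧ K₊ ⟶ Y` adjoint to `A ⟶ Map(K, Y)`. -/
def uncurry {K : SSet.{u}} {A Y : Spt.{u}} (g : A ⟶ cot K Y) : tens A K ⟶ Y :=
  Hom.mk (fun k => smashDesc (B := plus K)
      (fun n a (y : Option (K.obj n)) => y.elim ((Y.level k).pt n)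
        (fun x => cfn (ev g k n a) n (𝟙 n) x))
      (fun n y => by
        rcases y with _ | x
        · rfl
        · change cfn (ev g k n _) n (𝟙 n) x = _
          rw [ev_pt, cfn_pt])
      (fun n a => rfl)
      (fun {m n} s a y => by
        rcases y with _ | x
        · exact (PSSet.map_pt _ s).symm
        · change cfn (ev g k n _) n (𝟙 n) (K.map s x) =
            (Y.level k).X.map s (cfn (ev g k m a) m (𝟙 m) x)
          rw [← cfn_nat, ev_map, cfn_map, Category.comp_id, Category.id_comp]))
    (comm_of_bd _ fun k n s x => by
      induction x using tens_ind with
      | h a y =>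
        rw [tens_bd]
        rcases y with _ | x
        · exact (bd_pt _ _ _ _).symm
        · change cfn (ev g (k + 1) n _) n (𝟙 n) x =
            Y.bd k n s (cfn (ev g k n a) n (𝟙 n) x)
          rw [ev_bd, cfn_bd, Functor.map_id_apply])

lemma ev_uncurry {K : SSet.{u}} {A Y : Spt.{u}} (g : A ⟶ cot K Y) (k n) (a : A.S k n)
    (x : K.obj n) : ev (uncurry g) k n (tmk a (some x)) = cfn (ev g k n a) n (𝟙 n) x := rfl

/-- The adjunction between `A ∧ K₊` and `Map(K, Y)`. -/
def cotEquiv (K : SSet.{u}) (A Y : Spt.{u}) : (tens A K ⟶ Y) ≃ (A ⟶ cot K Y) where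
  toFun := curry
  invFun := uncurry
  left_inv f := by
    apply hom_ext
    intro k n x
    induction x using tens_ind with
    | h a y =>
      rcases y with _ | x
      · rw [tmk_none, ev_pt, ev_pt]
      · rw [ev_uncurry, cfn_curry, Functor.map_id_apply]
  right_inv g := by
    apply hom_ext
    intro k n a
    apply cot_ext; intro m t x
    rw [cfn_curry, ev_uncurry, ev_map, cfn_map, Category.comp_id]

lemma curry_comp {K : SSet.{u}} {A' A Y : Spt.{u}} (f : A' ⟶ A) (g : tens A K ⟶ Y) :
    curry (tensMap f (𝟙 K) ≫ g) = f ≫ curry g := by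
  apply hom_ext
  intro k n a
  apply cot_ext; intro m t x
  rw [ev_comp, cfn_curry, cfn_curry, ev_comp, ev_tensMap, ev_map]
  rfl

/-- The tensor functor `- ∧ K₊` has a right adjoint. -/
instance (K : SSet.{u}) : (tensor.obj K).IsLeftAdjoint :=
  (Adjunction.adjunctionOfEquivRight (F := tensor.obj K) (cotEquiv K)
    (fun _ _ _ f g => curry_comp f g)).isLeftAdjoint

end Spt

/-! ### Homotopy limits in a category tensored over simplicial sets -/

section Holim

variable {M : Type*} [Category* M] (T : SSet.{u} ⥤ M ⥤ M) [∀ K, (T.obj K).IsLeftAdjoint]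

/-- The cotensor `Y ↦ Y^K`, the right adjoint of the tensor `A ↦ A ⊗ K`. -/
noncomputable def cotensor (K : SSet.{u}) : M ⥤ M := (T.obj K).rightAdjoint

/-- The map `Y^L ⟶ Y^K` induced by a map `f : K ⟶ L` of simplicial sets, the transpose of
`A ⊗ K ⟶ A ⊗ L`. -/
noncomputable def cotensorMap {K L : SSet.{u}} (f : K ⟶ L) : cotensor T L ⟶ cotensor T K :=
  conjugateEquiv (Adjunction.ofIsLeftAdjoint (T.obj L)) (Adjunction.ofIsLeftAdjoint (T.obj K))
    (T.map f)

variable {C : Type u} [SmallCategory C] [HasProducts.{u} M]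

/-- `∏_c X(c)^{B(C ↓ c)}` -/
noncomputable abbrev holimSource (X : C ⥤ M) : M :=
  ∏ᶜ fun c : C => (cotensor T (nerve (Over c))).obj (X.obj c)

/-- `∏_{σ : c → d} X(d)^{B(C ↓ c)}`, the product being over all the morphisms of `C`. -/
noncomputable abbrev holimTarget (X : C ⥤ M) : M :=
  ∏ᶜ fun σ : Arrow C => (cotensor T (nerve (Over σ.left))).obj (X.obj σ.right)

/-- The map `α`, with `σ : c → d` component `X(c)^{B(C ↓ c)} ⟶ X(d)^{B(C ↓ c)}`. -/
noncomputable def holimAlpha (X : C ⥤ M) : holimSource T X ⟶ holimTarget T X :=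
  Pi.lift fun σ => Pi.π _ σ.left ≫ (cotensor T (nerve (Over σ.left))).map (X.map σ.hom)

/-- The map `β`, with `σ : c → d` component `X(d)^{B(C ↓ d)} ⟶ X(d)^{B(C ↓ c)}`. -/
noncomputable def holimBeta (X : C ⥤ M) : holimSource T X ⟶ holimTarget T X :=
  Pi.lift fun σ => Pi.π _ σ.right ≫
    (cotensorMap T (nerveMap (Over.map σ.hom))).app (X.obj σ.right)

/-- The map on `∏_c X(c)^{B(C ↓ c)}` induced by a map of diagrams. -/
noncomputable def holimSourceMap {X Y : C ⥤ M} (f : X ⟶ Y) : holimSource T X ⟶ holimSource T Y :=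
  Limits.Pi.map fun c => (cotensor T (nerve (Over c))).map (f.app c)

/-- The map on `∏_σ X(d)^{B(C ↓ c)}` induced by a map of diagrams. -/
noncomputable def holimTargetMap {X Y : C ⥤ M} (f : X ⟶ Y) : holimTarget T X ⟶ holimTarget T Y :=
  Limits.Pi.map fun σ => (cotensor T (nerve (Over σ.left))).map (f.app σ.right)

lemma holimAlpha_naturality {X Y : C ⥤ M} (f : X ⟶ Y) :
    holimAlpha T X ≫ holimTargetMap T f = holimSourceMap T f ≫ holimAlpha T Y := by
  apply Pi.hom_ext
  intro σ
  simp [holimAlpha, holimTargetMap, holimSourceMap, ← Functor.map_comp]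

lemma holimBeta_naturality {X Y : C ⥤ M} (f : X ⟶ Y) :
    holimBeta T X ≫ holimTargetMap T f = holimSourceMap T f ≫ holimBeta T Y := by
  apply Pi.hom_ext
  intro σ
  simp [holimBeta, holimTargetMap, holimSourceMap]

/-- The homotopy limit of `C`-diagrams in `M`: the equalizer of `α` and `β`. -/
noncomputable def holim [HasEqualizers M] : (C ⥤ M) ⥤ M where
  obj X := equalizer (holimAlpha T X) (holimBeta T X)
  map {X Y} f := equalizer.lift (equalizer.ι _ _ ≫ holimSourceMap T f) (by
    rw [Category.assoc, Category.assoc, ← holimAlpha_naturality, ← holimBeta_naturality,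
      equalizer.condition_assoc])
  map_id X := by
    apply equalizer.hom_ext
    simp [holimSourceMap]
  map_comp f g := by
    apply equalizer.hom_ext
    rw [equalizer.lift_ι, Category.assoc, equalizer.lift_ι, equalizer.lift_ι_assoc,
      Category.assoc]
    congr 1
    apply Pi.hom_ext
    intro c
    simp [holimSourceMap]

end Holim

/-! ### Discrete `G`-spectra -/

namespace GSpt

open Spt

section Sub

variable {G : Type u} [Group G]

/-- The action of `g` on a simplex of a `G`-spectrum. -/
def act (Y : Action Spt.{u} G) (g : G) {k : ℕ} {n : SimplexCategoryᵒᵖ} (x : Y.V.S k n) :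
    Y.V.S k n := ev (Y.ρ g) k n x

lemma act_one (Y : Action Spt.{u} G) {k n} (x : Y.V.S k n) : act Y 1 x = x := by
  rw [act, Y.ρ.map_one]; rfl

lemma act_mul (Y : Action Spt.{u} G) (g h : G) {k n} (x : Y.V.S k n) :
    act Y (g * h) x = act Y g (act Y h x) := by
  rw [act, Y.ρ.map_mul]; rfl

/-- A `G`-invariant subspectrum of a `G`-spectrum. -/
structure SubG (Y : Action Spt.{u} G) where
  mem : ∀ k n, Set (Y.V.S k n)
  map_mem : ∀ {k m n} (s : m ⟶ n) {x : Y.V.S k m}, x ∈ mem k m → (Y.V.level k).X.map s x ∈ mem k n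
  pt_mem : ∀ k n, (Y.V.level k).pt n ∈ mem k n
  bd_mem : ∀ {k n} (s) {x : Y.V.S k n}, x ∈ mem k n → Y.V.bd k n s x ∈ mem (k + 1) n
  act_mem : ∀ {k n} (g : G) {x : Y.V.S k n}, x ∈ mem k n → act Y g x ∈ mem k n

variable {Y : Action Spt.{u} G}

/-- The spectrum underlying an invariant subspectrum. -/
def SubG.spt (P : SubG Y) : Spt.{u} :=
  Spt.mk'
    (fun k =>
      { X :=
          { obj := fun n => { x : Y.V.S k n // x ∈ P.mem k n }
            map := fun s => ↾fun x => ⟨(Y.V.level k).X.map s x.1, P.map_mem s x.2⟩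
            map_id := fun n => by ext x; simp
            map_comp := fun s t => by ext x; simp }
        pt := fun n => ⟨(Y.V.level k).pt n, P.pt_mem k n⟩
        map_pt := fun s => by apply Subtype.ext; simp })
    (fun k n s x => ⟨Y.V.bd k n s x.1, P.bd_mem s x.2⟩)
    (fun k n x => by apply Subtype.ext; simp)
    (fun k n s => by apply Subtype.ext; simp)
    (fun k m n t s x => by
      apply Subtype.ext
      exact bd_map _ k t s _)

/-- The `G`-spectrum underlying an invariant subspectrum. -/
def SubG.toAction (P : SubG Y) : Action Spt.{u} G where
  V := P.spt
  ρ :=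
    { toFun := fun g => Spt.mkHom (fun k n x => ⟨act Y g x.1, P.act_mem g x.2⟩)
        (fun k m n s x => by apply Subtype.ext; exact ev_map _ _ _ _)
        (fun k n => by apply Subtype.ext; exact ev_pt _ _ _)
        (fun k n s x => by apply Subtype.ext; exact ev_bd _ _ _ _ _)
      map_one' := by
        apply Spt.hom_ext
        intro k n x
        apply Subtype.ext
        exact act_one Y x.1
      map_mul' := fun g h => by
        apply Spt.hom_ext
        intro k n x
        apply Subtype.ext
        exact act_mul Y g h x.1 }

lemma SubG.act_val (P : SubG Y) (g : G) {k n} (x : P.toAction.V.S k n) :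
    (act P.toAction g x).1 = act Y g x.1 := rfl

/-- The inclusion of one invariant subspectrum in another. -/
def SubG.incl {P Q : SubG Y} (h : ∀ k n, P.mem k n ⊆ Q.mem k n) : P.toAction ⟶ Q.toAction where
  hom := Spt.mkHom (fun k n x => ⟨x.1, h k n x.2⟩) (fun _ _ _ _ _ => rfl) (fun _ _ => rfl)
    (fun _ _ _ _ => rfl)
  comm _ := rfl

end Sub

variable (G : Type u) [Group G] [TopologicalSpace G]

/-- A `G`-spectrum is discrete if, for all `k` and `n`, the action map
`G × (Y_k)_n → (Y_k)_n` is continuous for the discrete topology on `(Y_k)_n`. -/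
def IsDiscrete : ObjectProperty (Action Spt.{u} G) := fun Y =>
  ∀ (k : ℕ) (n : SimplexCategoryᵒᵖ), letI : TopologicalSpace (Y.V.S k n) := ⊥
    Continuous fun p : G × Y.V.S k n => act Y p.1 p.2

/-- The category `Spt_G` of discrete `G`-spectra and `G`-equivariant maps of spectra. -/
abbrev SptG : Type (u + 1) := (IsDiscrete.{u} G).FullSubcategory

/-- The forgetful functor from discrete `G`-spectra to spectra. -/
abbrev SptG.forget : SptG.{u} G ⥤ Spt.{u} := (IsDiscrete.{u} G).ι ⋙ Action.forget Spt.{u} G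

variable {G} [IsTopologicalGroup G]

/-- A `G`-spectrum is discrete if and only if all stabilizers of simplices are open. -/
lemma isDiscrete_iff (Y : Action Spt.{u} G) :
    IsDiscrete G Y ↔ ∀ k n (x : Y.V.S k n), IsOpen {g | act Y g x = x} := by
  refine forall_congr' fun k => forall_congr' fun n => ?_
  let _ : TopologicalSpace (Y.V.S k n) := ⊥
  have _ : DiscreteTopology (Y.V.S k n) := ⟨rfl⟩
  constructor
  · intro h x
    have h' : Continuous fun g : G => act Y g x :=
      Continuous.comp (g := fun p : G × Y.V.S k n => act Y p.1 p.2) h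
        (continuous_id.prodMk continuous_const)
    exact (isOpen_discrete {x}).preimage h'
  · intro h
    change Continuous fun p : G × Y.V.S k n => act Y p.1 p.2
    rw [continuous_iff_continuousAt]
    rintro ⟨g, x⟩
    rw [ContinuousAt, nhds_discrete (Y.V.S k n), Filter.tendsto_pure]
    have hU : IsOpen ({g' | act Y (g⁻¹ * g') x = x} ×ˢ ({x} : Set (Y.V.S k n))) :=
      ((h x).preimage (continuous_const_mul g⁻¹)).prod (isOpen_discrete _)
    filter_upwards [hU.mem_nhds (x := (g, x)) (by simp [act_one])]
    rintro ⟨g', y⟩ ⟨h1, h2⟩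
    obtain rfl : y = x := h2
    have h1 : act Y (g⁻¹ * g') y = y := h1
    change act Y g' y = act Y g y
    conv_rhs => rw [← h1]
    rw [← act_mul, mul_inv_cancel_left]

/-- The stabilizer of a simplex. -/
def stab (Y : Action Spt.{u} G) {k n} (x : Y.V.S k n) : Subgroup G where
  carrier := {g | act Y g x = x}
  one_mem' := act_one Y x
  mul_mem' {a b} ha hb := by
    change act Y (a * b) x = x
    rw [act_mul, show act Y b x = x from hb, show act Y a x = x from ha]
  inv_mem' {a} ha := by
    change act Y a⁻¹ x = x
    conv_lhs => rw [← show act Y a x = x from ha]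
    rw [← act_mul, inv_mul_cancel, act_one]

lemma isOpen_stab_of_imp {Y Z : Action Spt.{u} G} {k n l m} {x : Y.V.S k n} {y : Z.V.S l m}
    (hx : IsOpen {g | act Y g x = x}) (h : ∀ g, act Y g x = x → act Z g y = y) :
    IsOpen {g | act Z g y = y} :=
  Subgroup.isOpen_mono (H₁ := stab Y x) (H₂ := stab Z y) h hx

/-- The simplices with open stabilizer. -/
def discSub (Y : Action Spt.{u} G) : SubG Y where
  mem k n := {x | IsOpen {g | act Y g x = x}}
  map_mem {k m n} s x hx := isOpen_stab_of_imp (Y := Y) (Z := Y) hx fun g h => by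
    rw [act] at h ⊢; rw [ev_map, h]
  pt_mem k n := by
    have : {g | act Y g ((Y.V.level k).pt n) = (Y.V.level k).pt n} = Set.univ := by
      ext g; simp [act]
    rw [Set.mem_ofPred_eq, this]; exact isOpen_univ
  bd_mem {k n} s x hx := isOpen_stab_of_imp (Y := Y) (Z := Y) hx fun g h => by
    rw [act] at h ⊢; rw [ev_bd, h]
  act_mem {k n} g x hx := by
    have : {h | act Y h (act Y g x) = act Y g x} =
        (fun h => g⁻¹ * h * g) ⁻¹' {h | act Y h x = x} := by
      ext h
      simp only [Set.mem_ofPred_eq, Set.mem_preimage, act_mul]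
      constructor
      · intro e; rw [e, ← act_mul, inv_mul_cancel, act_one]
      · intro e
        have := congrArg (act Y g) e
        rwa [← act_mul Y g g⁻¹, mul_inv_cancel, act_one] at this
    rw [Set.mem_ofPred_eq, this]
    exact IsOpen.preimage (by fun_prop) hx

/-- The largest discrete sub-`G`-spectrum of a `G`-spectrum. -/
def disc (Y : Action Spt.{u} G) : SptG.{u} G where
  obj := (discSub Y).toAction
  property := (isDiscrete_iff _).2 fun k n x => by
    have : {g | act (discSub Y).toAction g x = x} = {g | act Y g x.1 = x.1} := by
      ext g; exact Subtype.ext_iff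
    rw [this]; exact x.2

/-- Maps from a discrete `G`-spectrum land in the largest discrete sub-`G`-spectrum. -/
def discEquiv (A : SptG.{u} G) (Y : Action Spt.{u} G) : (A.obj ⟶ Y) ≃ (A ⟶ disc Y) where
  toFun f := ObjectProperty.homMk
    { hom := Spt.mkHom (fun k n x => ⟨ev f.hom k n x,
        isOpen_stab_of_imp (Y := A.obj) (Z := Y) ((isDiscrete_iff _).1 A.property k n x)
          fun g h => by
            have := congr_ev (f.comm g) k n x
            rw [ev_comp, ev_comp] at this
            rw [act] at h
            rw [act, ← this, h]⟩)
        (fun k m n s x => by apply Subtype.ext; exact ev_map _ _ _ _)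
        (fun k n => by apply Subtype.ext; exact ev_pt _ _ _)
        (fun k n s x => by apply Subtype.ext; exact ev_bd _ _ _ _ _)
      comm := fun g => by
        apply Spt.hom_ext
        intro k n x
        apply Subtype.ext
        exact congr_ev (f.comm g) k n x }
  invFun f :=
    { hom := Spt.mkHom (fun k n x => (ev f.hom.hom k n x).1)
        (fun k m n s x => congrArg Subtype.val (ev_map f.hom.hom k s x))
        (fun k n => congrArg Subtype.val (ev_pt f.hom.hom k n))
        (fun k n s x => congrArg Subtype.val (ev_bd f.hom.hom k n s x))
      comm := fun g => by
        apply Spt.hom_ext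
        intro k n x
        exact congrArg Subtype.val (congr_ev (f.hom.comm g) k n x) }
  left_inv _ := rfl
  right_inv _ := rfl

noncomputable instance : Coreflective (IsDiscrete.{u} G).ι where
  R := Adjunction.rightAdjointOfEquiv (F := (IsDiscrete.{u} G).ι) discEquiv (fun _ _ _ _ _ => rfl)
  adj := Adjunction.adjunctionOfEquivRight (F := (IsDiscrete.{u} G).ι) discEquiv
    (fun _ _ _ _ _ => rfl)

instance : HasLimits (SptG.{u} G) := hasLimits_of_coreflective (IsDiscrete.{u} G).ι

/-- The tensor `A ∧ K₊` of a discrete `G`-spectrum, with `G` acting on `A` only, is discrete. -/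
lemma isDiscrete_tensor (K : SSet.{u}) (A : Action Spt.{u} G) (hA : IsDiscrete G A) :
    IsDiscrete G (((Spt.tensor.obj K).mapAction G).obj A) := by
  rw [isDiscrete_iff] at hA ⊢
  intro k n
  refine tens_ind (X := A.V) (K := K) ?_
  intro x y
  refine isOpen_stab_of_imp (Y := A) (Z := ((Spt.tensor.obj K).mapAction G).obj A)
    (hA k n x) fun g h => ?_
  change ev (tensMap (A.ρ g) (𝟙 K)) k n (tmk x y) = tmk x y
  rw [ev_tensMap, show ev (A.ρ g) k n x = x from h]
  rcases y with _ | y <;> rfl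

/-- The tensoring of discrete `G`-spectra over simplicial sets: `K ↦ (A ↦ A ∧ K₊)`, where `G`
acts on `A` only. -/
def tensorG : SSet.{u} ⥤ SptG.{u} G ⥤ SptG.{u} G where
  obj K := (IsDiscrete.{u} G).lift ((IsDiscrete.{u} G).ι ⋙ (Spt.tensor.obj K).mapAction G)
    (fun A => isDiscrete_tensor K A.obj A.property)
  map f :=
    { app := fun A => ObjectProperty.homMk
        { hom := (Spt.tensor.map f).app A.obj.V
          comm := fun g => (Spt.tensor.map f).naturality (A.obj.ρ g) }
      naturality := fun A B h => by
        apply ObjectProperty.hom_ext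
        apply Action.hom_ext
        exact (Spt.tensor.map f).naturality h.hom.hom }
  map_id K := by
    ext A : 4
    exact congrArg (fun φ => NatTrans.app φ A.obj.V) (Spt.tensor.map_id K)
  map_comp f g := by
    ext A : 4
    exact congrArg (fun φ => NatTrans.app φ A.obj.V) (Spt.tensor.map_comp f g)

/-- An adjunction lifts to objects with a `G`-action. -/
def mapActionAdj {V W : Type*} [Category* V] [Category* W] {L : V ⥤ W} {R : W ⥤ V} (adj : L ⊣ R) :
    L.mapAction G ⊣ R.mapAction G where
  unit :=
    { app := fun A => { hom := adj.unit.app A.V, comm := fun g => adj.unit.naturality (A.ρ g) }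
      naturality := fun A B f => by
        apply Action.hom_ext
        exact adj.unit.naturality f.hom }
  counit :=
    { app := fun A => { hom := adj.counit.app A.V, comm := fun g => adj.counit.naturality (A.ρ g) }
      naturality := fun A B f => by
        apply Action.hom_ext
        exact adj.counit.naturality f.hom }
  left_triangle_components A := by
    apply Action.hom_ext
    exact adj.left_triangle_components A.V
  right_triangle_components A := by
    apply Action.hom_ext
    exact adj.right_triangle_components A.V

/-- The tensor functor `- ∧ K₊` on discrete `G`-spectra has a right adjoint. -/
instance (K : SSet.{u}) : ((tensorG (G := G)).obj K).IsLeftAdjoint :=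
  (Adjunction.restrictFullyFaithful (L := (tensorG (G := G)).obj K)
    ((coreflectorAdjunction (IsDiscrete.{u} G).ι).comp
      (mapActionAdj (G := G) (Adjunction.ofIsLeftAdjoint (Spt.tensor.obj K))))
    (Functor.FullyFaithful.id _) (IsDiscrete.{u} G).fullyFaithfulι
    (Iso.refl _) (Functor.rightUnitor _).symm).isLeftAdjoint

/-- The fixed points `Y^N` of a normal subgroup `N`, as a `G`-invariant subspectrum. -/
def fixSub (Y : Action Spt.{u} G) (N : Subgroup G) [N.Normal] : SubG Y where
  mem k n := {x | ∀ h ∈ N, act Y h x = x}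
  map_mem {k m n} s x hx h hh := by
    have := hx h hh
    rw [act] at this ⊢; rw [ev_map, this]
  pt_mem k n h _ := ev_pt _ _ _
  bd_mem {k n} s x hx h hh := by
    have := hx h hh
    rw [act] at this ⊢; rw [ev_bd, this]
  act_mem {k n} g x hx h hh := by
    have := hx (g⁻¹ * h * g) (by simpa using Subgroup.Normal.conj_mem ‹_› h hh g⁻¹)
    have := congrArg (act Y g) this
    simpa [← act_mul, mul_assoc] using this

/-- The diagram `N ↦ Y^N` of discrete `G`-spectra indexed by the open normal subgroups of `G`,
where `Y^{N'} ⟶ Y^N` is the inclusion if `N ≤ N'`. -/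
def fixedPoints (Y : Action Spt.{u} G) : (OpenNormalSubgroup G)ᵒᵖ ⥤ SptG.{u} G where
  obj N :=
    { obj := (fixSub Y N.unop.toSubgroup).toAction
      property := (isDiscrete_iff _).2 fun _ _ x =>
        Subgroup.isOpen_mono (H₁ := N.unop.toSubgroup) (H₂ := stab _ x)
          (fun h hh => show act _ h x = x from Subtype.ext (x.2 h hh)) N.unop.isOpen' }
  map f := ObjectProperty.homMk (SubG.incl fun _ _ _ hx h hh => hx h (leOfHom f.unop hh))
  map_id _ := rfl
  map_comp _ _ := rfl

/-- The action of `g` on the underlying diagram of spectra of a diagram of discrete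
`G`-spectra. -/
def diagAct {C : Type u} [SmallCategory C] (X : C ⥤ SptG.{u} G) (g : G) :
    (X ⋙ SptG.forget G) ⟶ (X ⋙ SptG.forget G) where
  app c := (X.obj c).obj.ρ g
  naturality _ _ f := ((X.map f).hom.comm g).symm

lemma diagAct_one {C : Type u} [SmallCategory C] (X : C ⥤ SptG.{u} G) :
    diagAct X 1 = 𝟙 (X ⋙ SptG.forget G) := by
  ext c : 2
  exact (X.obj c).obj.ρ.map_one

lemma diagAct_mul {C : Type u} [SmallCategory C] (X : C ⥤ SptG.{u} G) (g h : G) :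
    diagAct X (g * h) = diagAct X h ≫ diagAct X g := by
  ext c : 2
  exact (X.obj c).obj.ρ.map_mul g h

/-- The spectrum `holim_C X` of a diagram of discrete `G`-spectra, formed in spectra, with the
`G`-action induced by functoriality from the actions on the `X(c)`. -/
noncomputable def holimSpt {C : Type u} [SmallCategory C] (X : C ⥤ SptG.{u} G) :
    Action Spt.{u} G where
  V := (holim Spt.tensor.{u}).obj (X ⋙ SptG.forget G)
  ρ :=
    { toFun := fun g => (holim Spt.tensor.{u}).map (diagAct X g)
      map_one' := by rw [diagAct_one, CategoryTheory.Functor.map_id]; rfl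
      map_mul' := fun g h => by rw [diagAct_mul, CategoryTheory.Functor.map_comp]; rfl }

/-- The homotopy limit of a diagram of discrete `G`-spectra, formed in `Spt_G`. -/
noncomputable abbrev holimG {C : Type u} [SmallCategory C] (X : C ⥤ SptG.{u} G) : SptG.{u} G :=
  (holim (tensorG (G := G))).obj X

end GSpt

/-! Both sides represent the same functor on discrete `G`-spectra. By adjunction, a map from `A` to
a homotopy limit is a family of maps `A ∧ B(C ↓ c)₊ ⟶ X(c)` compatible with the morphisms of `C`
(`HolimCone`). This uses only the tensor, so no formula for the cotensor in either category is
needed, although the two cotensors differ.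

The tensor in `Spt_G` is the tensor in `Spt` with `G` acting on `A` alone. Hence a compatible family
in `Spt_G` is a compatible family in `Spt` with equivariant components. Since components determine a
map, this is the same as an equivariant map from `A` to `holimSpt X`, whose action need not be
discrete (`holimGHomEquiv`). An equivariant map out of a discrete `A` takes values in simplices with
open stabilizer, so it factors uniquely through `disc (holimSpt X)` (`discEquiv`). The Yoneda lemma
then identifies `holimG X` with `disc (holimSpt X)` (`holimGIso`).

It remains to see that `disc Y` is the colimit of the fixed points `Y^N` for every `G`-spectrum `Y`.
In a profinite group every open subgroup contains an open normal one, so `disc Y` is the union of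
the `Y^N`. The union is directed, because `N ⊓ N'` is again open and normal, and a directed union of
subspectra is a colimit in `Spt`. The induced map is equivariant as soon as the cocone is, which
gives the colimit in `Spt_G`. -/

/-! ### Maps into a homotopy limit, described by components -/

section Holim

variable {M : Type*} [Category* M] (T : SSet.{u} ⥤ M ⥤ M) [∀ K, (T.obj K).IsLeftAdjoint]

/-- The adjunction between the tensor and the cotensor with `K`, as a bijection on maps. -/
noncomputable def cotensorEquiv (K : SSet.{u}) (A Y : M) :
    ((T.obj K).obj A ⟶ Y) ≃ (A ⟶ (cotensor T K).obj Y) :=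
  (Adjunction.ofIsLeftAdjoint (T.obj K)).homEquiv A Y

lemma cotensorEquiv_comp (K : SSet.{u}) {A Y Z : M} (f : (T.obj K).obj A ⟶ Y) (g : Y ⟶ Z) :
    cotensorEquiv T K A Z (f ≫ g) = cotensorEquiv T K A Y f ≫ (cotensor T K).map g :=
  Adjunction.homEquiv_naturality_right _ f g

lemma cotensorEquiv_map_comp (K : SSet.{u}) {A B Y : M} (h : A ⟶ B)
    (f : (T.obj K).obj B ⟶ Y) :
    cotensorEquiv T K A Y ((T.obj K).map h ≫ f) = h ≫ cotensorEquiv T K B Y f :=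
  Adjunction.homEquiv_naturality_left _ h f

/-- `cotensorMap T k` is by definition the mate of `T.map k`, so precomposition with `T.map k`
transposes to postcomposition with it. This turns the `β` side of the equalizer condition into a
statement about tensors. -/
lemma cotensorEquiv_app_comp {K L : SSet.{u}} (k : K ⟶ L) {A Y : M}
    (f : (T.obj L).obj A ⟶ Y) :
    cotensorEquiv T K A Y ((T.map k).app A ≫ f) =
      cotensorEquiv T L A Y f ≫ (cotensorMap T k).app Y := by
  -- The case `f = 𝟙`: the defining relation between mates and units. The general case follows by
  -- composing with the image of `f` and using naturality of `cotensorMap T k`.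
  have h := unit_conjugateEquiv (Adjunction.ofIsLeftAdjoint (T.obj L))
    (Adjunction.ofIsLeftAdjoint (T.obj K)) (T.map k) A
  have e := congrArg (· ≫ (cotensor T K).map f) h
  rw [cotensorEquiv_comp]
  refine Eq.trans (congrArg (· ≫ (cotensor T K).map f) (Adjunction.homEquiv_unit _ _ _ _)) ?_
  refine e.symm.trans ?_
  refine Eq.trans ?_ (congrArg (· ≫ (cotensorMap T k).app Y)
    (Adjunction.homEquiv_unit _ _ _ _).symm)
  refine (Category.assoc _ _ _).trans (Eq.trans ?_ (Category.assoc _ _ _).symm)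
  exact congrArg (_ ≫ ·) ((cotensorMap T k).naturality f).symm

variable {C : Type u} [SmallCategory C]

/-- The families of maps `A ⊗ B(C ↓ c) ⟶ X(c)` that are compatible with the morphisms of `C`:
these are the maps from `A` to the homotopy limit of `X`. -/
structure HolimCone (A : M) (X : C ⥤ M) where
  app : ∀ c, (T.obj (nerve (Over c))).obj A ⟶ X.obj c
  w : ∀ {c d} (σ : c ⟶ d), app c ≫ X.map σ = (T.map (nerveMap (Over.map σ))).app A ≫ app d

variable [HasProducts.{u} M] [HasEqualizers M]

/-- The projection from the homotopy limit of `X` to `X(c)^{B(C ↓ c)}`. -/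
noncomputable def holimProj (X : C ⥤ M) (c : C) :
    (holim T).obj X ⟶ (cotensor T (nerve (Over c))).obj (X.obj c) :=
  equalizer.ι (holimAlpha T X) (holimBeta T X) ≫ Pi.π _ c

/-- The component at `σ` of the equation that the equalizer imposes on `α` and `β`. -/
lemma holimProj_w (X : C ⥤ M) {c d : C} (σ : c ⟶ d) :
    holimProj T X c ≫ (cotensor T (nerve (Over c))).map (X.map σ) =
      holimProj T X d ≫ (cotensorMap T (nerveMap (Over.map σ))).app (X.obj d) := by
  have := equalizer.condition (holimAlpha T X) (holimBeta T X) =≫ Pi.π _ (Arrow.mk σ)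
  simp only [holimAlpha, holimBeta, Category.assoc, Pi.lift_π] at this
  exact (Category.assoc _ _ _).trans (this.trans (Category.assoc _ _ _).symm)

lemma holim_map_comp_holimProj {X Y : C ⥤ M} (f : X ⟶ Y) (c : C) :
    (holim T).map f ≫ holimProj T Y c =
      holimProj T X c ≫ (cotensor T (nerve (Over c))).map (f.app c) := by
  refine (Category.assoc _ _ _).symm.trans ?_
  refine (congrArg (· ≫ _) (equalizer.lift_ι _ _)).trans ?_
  refine (Category.assoc _ _ _).trans (Eq.trans ?_ (Category.assoc _ _ _).symm)
  exact congrArg (_ ≫ ·) (Pi.map_π _ _)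

/-- The `c`-component of a map to the homotopy limit. -/
noncomputable def holimComponent {A : M} {X : C ⥤ M} (φ : A ⟶ (holim T).obj X) (c : C) :
    (T.obj (nerve (Over c))).obj A ⟶ X.obj c :=
  (cotensorEquiv T _ _ _).symm (φ ≫ holimProj T X c)

lemma cotensorEquiv_holimComponent {A : M} {X : C ⥤ M} (φ : A ⟶ (holim T).obj X) (c : C) :
    cotensorEquiv T _ _ _ (holimComponent T φ c) = φ ≫ holimProj T X c :=
  Equiv.apply_symm_apply _ _

/-- The inclusion of an equalizer is monic, projections from a product are jointly monic, and
transposition is injective. -/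
lemma holim_hom_ext {A : M} {X : C ⥤ M} {φ ψ : A ⟶ (holim T).obj X}
    (h : ∀ c, holimComponent T φ c = holimComponent T ψ c) : φ = ψ := by
  refine equalizer.hom_ext (Pi.hom_ext _ _ fun c => ?_)
  have := congrArg (cotensorEquiv T _ _ _) (h c)
  rw [cotensorEquiv_holimComponent, cotensorEquiv_holimComponent] at this
  exact (Category.assoc _ _ _).trans (this.trans (Category.assoc _ _ _).symm)

/-- Transposing both sides gives `holimProj_w` precomposed with `φ`. -/
lemma holimComponent_w {A : M} {X : C ⥤ M} (φ : A ⟶ (holim T).obj X) {c d : C} (σ : c ⟶ d) :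
    holimComponent T φ c ≫ X.map σ =
      (T.map (nerveMap (Over.map σ))).app A ≫ holimComponent T φ d := by
  apply (cotensorEquiv T _ _ _).injective
  rw [cotensorEquiv_comp, cotensorEquiv_app_comp, cotensorEquiv_holimComponent,
    cotensorEquiv_holimComponent, Category.assoc, Category.assoc, holimProj_w]

lemma holimComponent_comp {A B : M} {X : C ⥤ M} (h : A ⟶ B) (φ : B ⟶ (holim T).obj X) (c : C) :
    holimComponent T (h ≫ φ) c = (T.obj _).map h ≫ holimComponent T φ c := by
  apply (cotensorEquiv T _ _ _).injective
  rw [cotensorEquiv_map_comp, cotensorEquiv_holimComponent, cotensorEquiv_holimComponent,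
    Category.assoc]

/-- With `f = diagAct X g` this computes the action of `g` on the homotopy limit: it acts on each
component through its action on `X(c)`. -/
lemma holimComponent_comp_map {A : M} {X Y : C ⥤ M} (φ : A ⟶ (holim T).obj X) (f : X ⟶ Y)
    (c : C) :
    holimComponent T (φ ≫ (holim T).map f) c = holimComponent T φ c ≫ f.app c := by
  apply (cotensorEquiv T _ _ _).injective
  rw [cotensorEquiv_comp, cotensorEquiv_holimComponent, cotensorEquiv_holimComponent,
    Category.assoc, Category.assoc, holim_map_comp_holimProj]

/-- The map to the homotopy limit with given components. -/
noncomputable def holimLift {A : M} {X : C ⥤ M} (s : HolimCone T A X) : A ⟶ (holim T).obj X :=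
  equalizer.lift (Pi.lift fun c => cotensorEquiv T _ _ _ (s.app c)) (by
    apply Pi.hom_ext
    intro σ
    -- At `σ`, the `α` side is the transpose of `s.app c ≫ X.map σ` and the `β` side is that of the
    -- other half of `s.w σ`.
    have := congrArg (cotensorEquiv T _ _ _) (s.w σ.hom)
    rw [cotensorEquiv_comp, cotensorEquiv_app_comp] at this
    simpa [holimAlpha, holimBeta] using this)

lemma holimComponent_holimLift {A : M} {X : C ⥤ M} (s : HolimCone T A X) (c : C) :
    holimComponent T (holimLift T s) c = s.app c := by
  apply (cotensorEquiv T _ _ _).injective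
  rw [cotensorEquiv_holimComponent]
  refine (Category.assoc _ _ _).symm.trans ?_
  refine (congrArg (· ≫ _) (equalizer.lift_ι _ _)).trans ?_
  exact Pi.lift_π _ _

end Holim

namespace GSpt

open Spt

variable {G : Type u} [Group G] [TopologicalSpace G] [IsTopologicalGroup G]

/-! ### Comparison of the homotopy limits in `Spt_G` and in `Spt` -/

section HolimG

variable {C : Type u} [SmallCategory C] (X : C ⥤ SptG.{u} G)

variable {X} in
/-- The `c`-component of a map to the homotopy limit in spectra. -/
noncomputable def holimSptComponent {A : Spt.{u}} (ψ : A ⟶ (holimSpt X).V) (c : C) :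
    tens A (nerve (Over c)) ⟶ (X.obj c).obj.V :=
  holimComponent Spt.tensor.{u} (X := X ⋙ SptG.forget G) ψ c

variable {X} in
lemma holimSpt_hom_ext {A : Spt.{u}} {φ ψ : A ⟶ (holimSpt X).V}
    (h : ∀ c, holimSptComponent φ c = holimSptComponent ψ c) : φ = ψ :=
  holim_hom_ext Spt.tensor.{u} (X := X ⋙ SptG.forget G) h

variable {X} in
lemma holimSptComponent_comp {A B : Spt.{u}} (f : A ⟶ B) (ψ : B ⟶ (holimSpt X).V) (c : C) :
    holimSptComponent (f ≫ ψ) c = tensMap f (𝟙 _) ≫ holimSptComponent ψ c :=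
  holimComponent_comp Spt.tensor.{u} (X := X ⋙ SptG.forget G) f ψ c

variable {X} in
lemma holimSptComponent_comp_rho {A : Spt.{u}} (ψ : A ⟶ (holimSpt X).V) (g : G) (c : C) :
    holimSptComponent (ψ ≫ (holimSpt X).ρ g) c = holimSptComponent ψ c ≫ (X.obj c).obj.ρ g :=
  holimComponent_comp_map Spt.tensor.{u} (X := X ⋙ SptG.forget G) ψ (diagAct X g) c

/-- The map of spectra underlying a map to the homotopy limit in discrete `G`-spectra. -/
noncomputable def holimGUnderlying {A : SptG.{u} G} (φ : A ⟶ holimG X) :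
    A.obj.V ⟶ (holimSpt X).V :=
  holimLift Spt.tensor.{u} (X := X ⋙ SptG.forget G)
    { app := fun c => (holimComponent tensorG φ c).hom.hom
      -- Forgetting the action carries `tensorG` to `Spt.tensor` on the nose, so the compatibility
      -- in `Spt_G` is already the one required in `Spt`.
      w := fun σ => congrArg (fun f => f.hom.hom) (holimComponent_w tensorG φ σ) }

lemma holimSptComponent_holimGUnderlying {A : SptG.{u} G} (φ : A ⟶ holimG X) (c : C) :
    holimSptComponent (holimGUnderlying X φ) c = (holimComponent tensorG φ c).hom.hom :=
  holimComponent_holimLift Spt.tensor.{u} (X := X ⋙ SptG.forget G) _ c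

/-- The map to the homotopy limit in discrete `G`-spectra given by an equivariant map to the
homotopy limit in spectra. -/
noncomputable def holimGLift {A : SptG.{u} G} (ψ : A.obj ⟶ holimSpt X) : A ⟶ holimG X :=
  holimLift tensorG
    { app := fun c => ObjectProperty.homMk
        { hom := holimSptComponent ψ.hom c
          comm := fun g => by
            -- Comparing components of `ρ g ≫ ψ = ψ ≫ ρ g`: on the left `g` acts on the factor `A`
            -- of `A ∧ B(C ↓ c)₊`, which is the whole action there; on the right it acts on `X(c)`.
            have := congrArg (fun f => holimSptComponent f c) (ψ.comm g)
            exact (holimSptComponent_comp _ _ _).symm.trans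
              (this.trans (holimSptComponent_comp_rho _ _ _)) }
      w := fun σ => by
        apply ObjectProperty.hom_ext
        apply Action.hom_ext
        exact holimComponent_w Spt.tensor.{u} (X := X ⋙ SptG.forget G) ψ.hom σ }

lemma holimComponent_holimGLift {A : SptG.{u} G} (ψ : A.obj ⟶ holimSpt X) (c : C) :
    (holimComponent tensorG (holimGLift X ψ) c).hom.hom = holimSptComponent ψ.hom c :=
  congrArg (fun f : (tensorG.obj (nerve (Over c))).obj A ⟶ X.obj c => f.hom.hom)
    (holimComponent_holimLift tensorG _ c)

/-- Maps to the homotopy limit in discrete `G`-spectra are the equivariant maps to the homotopy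
limit in spectra. -/
noncomputable def holimGHomEquiv (A : SptG.{u} G) :
    (A ⟶ holimG X) ≃ (A.obj ⟶ holimSpt X) where
  toFun φ :=
    { hom := holimGUnderlying X φ
      comm := fun g => by
        refine holimSpt_hom_ext fun c => ?_
        rw [holimSptComponent_comp, holimSptComponent_comp_rho,
          holimSptComponent_holimGUnderlying]
        -- On components, equivariance into `holimSpt X` is equivariance of the maps `A ∧ B(C ↓ c)₊
        -- ⟶ X(c)`, which holds because these are maps in `Spt_G`.
        exact (holimComponent tensorG φ c).hom.comm g }
  invFun ψ := holimGLift X ψ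
  left_inv φ := by
    refine holim_hom_ext tensorG fun c => ?_
    apply ObjectProperty.hom_ext
    apply Action.hom_ext
    exact (holimComponent_holimGLift X _ c).trans (holimSptComponent_holimGUnderlying X φ c)
  right_inv ψ := by
    apply Action.hom_ext
    refine holimSpt_hom_ext fun c => ?_
    exact (holimSptComponent_holimGUnderlying X _ c).trans (holimComponent_holimGLift X ψ c)

/-- Naturality in the source, as required by the Yoneda lemma in `holimGIso`. -/
lemma holimGHomEquiv_comp {A B : SptG.{u} G} (f : A ⟶ B) (φ : B ⟶ holimG X) :
    holimGHomEquiv X A (f ≫ φ) = f.hom ≫ holimGHomEquiv X B φ := by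
  apply Action.hom_ext
  refine holimSpt_hom_ext fun c => ?_
  refine (holimSptComponent_holimGUnderlying X (f ≫ φ) c).trans ?_
  refine Eq.trans ?_ (holimSptComponent_comp f.hom.hom (holimGUnderlying X φ) c).symm
  rw [holimSptComponent_holimGUnderlying, holimComponent_comp]
  rfl

/-- The homotopy limit in discrete `G`-spectra is the largest discrete sub-`G`-spectrum of the
homotopy limit in spectra. -/
noncomputable def holimGIso : holimG X ≅ disc (holimSpt X) :=
  Yoneda.ext _ _ (fun {A} φ => discEquiv A _ (holimGHomEquiv X A φ))
    (fun {A} ψ => (holimGHomEquiv X A).symm ((discEquiv A _).symm ψ))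
    (fun φ => by simp) (fun ψ => by simp)
    (fun f φ => by rw [holimGHomEquiv_comp]; rfl)

end HolimG

/-! ### The largest discrete subspectrum as a colimit of fixed points -/

section FixedPoints

variable (Y : Action Spt.{u} G)

/-- The inclusions of the fixed points of the open normal subgroups in the largest discrete
sub-`G`-spectrum. -/
def discCocone : Cocone (fixedPoints Y) where
  pt := disc Y
  ι :=
    { app := fun N => ObjectProperty.homMk (SubG.incl fun _ _ x hx =>
        Subgroup.isOpen_mono (H₁ := N.unop.toSubgroup) (H₂ := stab Y x) (fun h hh => hx h hh)
          N.unop.isOpen')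
      naturality := fun _ _ _ => rfl }

variable {Y} in
/-- The value of a cocone on a simplex fixed by `N` does not depend on `N`. -/
lemma cocone_ev_eq (s : Cocone (fixedPoints Y ⋙ SptG.forget G)) {k n} (x : Y.V.S k n)
    (N N' : OpenNormalSubgroup G) (h : ∀ g ∈ N.toSubgroup, act Y g x = x)
    (h' : ∀ g ∈ N'.toSubgroup, act Y g x = x) :
    ev (s.ι.app (op N)) k n ⟨x, h⟩ = ev (s.ι.app (op N')) k n ⟨x, h'⟩ := by
  -- Both values agree with the value at `N ⊓ N'`, which also fixes `x`.
  have e := congr_ev (s.w (homOfLE (inf_le_left : N ⊓ N' ≤ N)).op) k n ⟨x, h⟩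
  have e' := congr_ev (s.w (homOfLE (inf_le_right : N ⊓ N' ≤ N')).op) k n ⟨x, h'⟩
  exact e.symm.trans e'

variable [CompactSpace G] [TotallyDisconnectedSpace G]

/-- A simplex with open stabilizer is fixed by an open normal subgroup. -/
lemma exists_openNormalSubgroup_fixing {k n} (x : Y.V.S k n) (hx : IsOpen {g | act Y g x = x}) :
    ∃ N : OpenNormalSubgroup G, ∀ h ∈ N.toSubgroup, act Y h x = x := by
  -- Profiniteness enters here: the stabilizer is an open neighbourhood of `1`, so it contains an
  -- open normal subgroup.
  obtain ⟨N, hN⟩ := ProfiniteGrp.exist_openNormalSubgroup_sub_open_nhds_of_one hx (act_one Y x)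
  exact ⟨N, fun h hh => hN hh⟩

/-- An open normal subgroup that fixes a given simplex with open stabilizer. -/
noncomputable def fixing {k n} (x : (disc Y).obj.V.S k n) : OpenNormalSubgroup G :=
  (exists_openNormalSubgroup_fixing Y x.1 x.2).choose

lemma fixing_spec {k n} (x : (disc Y).obj.V.S k n) : ∀ h ∈ (fixing Y x).toSubgroup,
    act Y h x.1 = x.1 :=
  (exists_openNormalSubgroup_fixing Y x.1 x.2).choose_spec

variable {Y}

/-- The map out of the largest discrete sub-`G`-spectrum induced by a cocone in spectra. -/
noncomputable def discDesc (s : Cocone (fixedPoints Y ⋙ SptG.forget G)) :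
    (disc Y).obj.V ⟶ s.pt :=
  Spt.mkHom (fun k n x => ev (s.ι.app (op (fixing Y x))) k n ⟨x.1, fixing_spec Y x⟩)
    -- The choices made by `fixing` for `x` and for its image under `t` are unrelated. The subgroup
    -- chosen for `x` fixes both simplices, so `cocone_ev_eq` moves the computation there. The
    -- bonding maps are treated alike.
    (fun k _ _ t x =>
      (cocone_ev_eq s ((Y.V.level k).X.map t x.1) _ (fixing Y x)
        (fixing_spec Y (((disc Y).obj.V.level k).X.map t x))
        ((fixSub Y (fixing Y x).toSubgroup).map_mem t (fixing_spec Y x))).trans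
        (ev_map (s.ι.app (op (fixing Y x))) k t (Subtype.mk x.1 (fixing_spec Y x))))
    (fun k n => ev_pt (s.ι.app (op (fixing Y (((disc Y).obj.V.level k).pt n)))) k n)
    (fun k n t x =>
      (cocone_ev_eq s (Y.V.bd k n t x.1) _ (fixing Y x)
        (fixing_spec Y ((disc Y).obj.V.bd k n t x))
        ((fixSub Y (fixing Y x).toSubgroup).bd_mem t (fixing_spec Y x))).trans
        (ev_bd (s.ι.app (op (fixing Y x))) k n t (Subtype.mk x.1 (fixing_spec Y x))))

/-- Removes the dependence on the choice in `fixing`: any open normal subgroup fixing `x` computes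
the value. The factorization through each `Y^N` follows. -/
lemma ev_discDesc (s : Cocone (fixedPoints Y ⋙ SptG.forget G)) {k n} (x : (disc Y).obj.V.S k n)
    (N : OpenNormalSubgroup G) (h : ∀ g ∈ N.toSubgroup, act Y g x.1 = x.1) :
    ev (discDesc s) k n x = ev (s.ι.app (op N)) k n ⟨x.1, h⟩ :=
  cocone_ev_eq s x.1 (fixing Y x) N (fixing_spec Y x) h

variable (Y)

/-- The largest discrete sub-`G`-spectrum of `Y` is the colimit in spectra of the fixed points of
`Y` under the open normal subgroups. -/
noncomputable def discCoconeForgetIsColimit :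
    IsColimit ((SptG.forget G).mapCocone (discCocone Y)) where
  desc s := discDesc s
  fac s N := by
    apply Spt.hom_ext
    intro k n x
    exact ev_discDesc s (ev ((discCocone Y).ι.app N).hom.hom k n x) N.unop x.2
  uniq s m hm := by
    apply Spt.hom_ext
    intro k n x
    -- Each simplex of `disc Y` comes from some `Y^N`, so `m` is determined by its restrictions.
    exact congr_ev (hm (op (fixing Y x))) k n ⟨x.1, fixing_spec Y x⟩

/-- The largest discrete sub-`G`-spectrum of `Y` is the colimit in discrete `G`-spectra of the
fixed points of `Y` under the open normal subgroups. -/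
noncomputable def discCoconeIsColimit : IsColimit (discCocone Y) where
  desc s := ObjectProperty.homMk
    { hom := discDesc ((SptG.forget G).mapCocone s)
      comm := fun g => by
        -- Equivariance may be tested on each `Y^N`, as these jointly cover `disc Y`; there the map
        -- is the leg of `s`, which is equivariant.
        apply (discCoconeForgetIsColimit Y).hom_ext
        intro N
        have e := (discCoconeForgetIsColimit Y).fac ((SptG.forget G).mapCocone s) N
        apply Spt.hom_ext
        intro k n x
        have e₁ := congr_ev e k n (act ((fixedPoints Y).obj N).obj g x)
        have e₂ := congr_ev e k n x
        have e₃ := congr_ev ((s.ι.app N).hom.comm g) k n x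
        exact e₁.trans (e₃.trans (congrArg (act s.pt.obj g) e₂.symm)) }
  fac s N := by
    apply ObjectProperty.hom_ext
    apply Action.hom_ext
    exact (discCoconeForgetIsColimit Y).fac ((SptG.forget G).mapCocone s) N
  uniq s m hm := by
    apply ObjectProperty.hom_ext
    apply Action.hom_ext
    exact (discCoconeForgetIsColimit Y).uniq ((SptG.forget G).mapCocone s) m.hom.hom
      fun N => congrArg (fun f => f.hom.hom) (hm N)

end FixedPoints

end GSpt

/-- A single cocone, with apex `disc (holimSpt X)`, witnesses all three claims, so the colimit in
`Spt` is the underlying spectrum of the colimit in `Spt_G`. -/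
theorem theorem2p3 {G : Type u} [Group G] [TopologicalSpace G] [IsTopologicalGroup G]
    [CompactSpace G] [TotallyDisconnectedSpace G] {C : Type u} [SmallCategory C]
    (X : C ⥤ GSpt.SptG.{u} G) :
    ∃ c : Cocone (GSpt.fixedPoints (GSpt.holimSpt X)),
      Nonempty (IsColimit c) ∧
      Nonempty (IsColimit ((GSpt.SptG.forget G).mapCocone c)) ∧
      Nonempty (GSpt.holimG X ≅ c.pt) :=
  ⟨GSpt.discCocone _, ⟨GSpt.discCoconeIsColimit _⟩, ⟨GSpt.discCoconeForgetIsColimit _⟩,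
    ⟨GSpt.holimGIso X⟩⟩
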